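/- Let $\gamma\in[0,1)$, $R_{\max}\in\mathbb R$ and let $K\ge 1$ be an integer. Let $\mathcal M$ be the class of Markov decision processes $(\mathcal X,\mathcal A,p,\gamma,\mathcal R)$ with non-empty finite state space $\mathcal X$, non-empty finite action space $\mathcal A$, transition probabilities $p(\cdot\mid x,a)$, discount factor $\gamma$, and reward distributions $\mathcal R(x,a)\in\mathscr P(\mathbb R)$ supported on $[-R_{\max},R_{\max}]$. For $\mu\in\mathscr P(\mathbb R)$ with distribution function $F_\mu$ put $s_k(\mu)=F_\mu^{-1}\big(\tfrac{2k-1}{2K}\big)$ for $k=1,\dots,K$, where $F_\mu^{-1}(\tau)=\inf\{t\in\mathbb R:\tau\le F_\mu(t)\}$, and for $\sigma\in\mathbb R^K$ put $\Psi(\sigma)=\frac1K\sum_{k=1}^K\delta_{\sigma_k}$. Given an MDP in $\mathcal M$ and a policy $\pi:\mathcal X\to\mathscr P(\mathcal A)$, let $\eta_\pi(x,a)$ be the law of $\sum_{t\ge0}\gamma^tR_t$ given $X_0=x$, $A_0=a$, where $R_t\sim\mathcal R(X_t,A_t)$, $X_{t+1}\sim p(\cdot\mid X_t,A_t)$ and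 $A_{t+1}\sim\pi(\cdot\mid X_{t+1})$. Let $\mathcal T^\pi$ be the distributional Bellman operator: $(\mathcal T^\pi\eta)(x,a)$ is the law of $R_0+\gamma Z$, where $R_0\sim\mathcal R(x,a)$, independently $X_1\sim p(\cdot\mid x,a)$, $A_1\sim\pi(\cdot\mid X_1)$, and, given these, $Z\sim\eta(X_1,A_1)$. Consider the dynamic programming update on tables $\hat s=(\hat s_k(x,a))$ of real numbers, $$(U\hat s)_k(x,a)=s_k\big((\mathcal T^\pi\eta)(x,a)\big),\qquad \eta(x',a')=\Psi\big(\hat s_{1:K}(x',a')\big).$$ Then $(s_1,\dots,s_K)$ together with $\Psi$ is $\varepsilon$-approximately Bellman closed for $\mathcal M$ with $\varepsilon=\frac{2R_{\max}(5-2\gamma)}{(1-\gamma)^2K}$. That is, for every MDP in $\mathcal M$ and every policy $\pi$, there is a (necessarily unique) table $\hat s$ of learnt values, which is a fixed point of $U$ and the limit of the iterates of $U$ from every initial table, and it satisfies $$\sup_{(x,a)\in\mathcal X\times\mathcal A}\frac1K\sum_{k=1}^K\big|s_k(\eta_\pi(x,a))-\hat s_k(x,a)\big|\le\frac{2R_{\max}(5-2\gamma)}{(1-\gamma)^2K}.$$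 -/

import Mathlib

open MeasureTheory ProbabilityTheory Filter Topology

universe u v

noncomputable section

namespace DistRL

/-! ### Statistics and imputation strategies -/

/-- A statistic: a real-valued function of probability distributions on the real line. -/
abbrev Statistic : Type := ProbabilityMeasure ℝ → ℝ

/-- An imputation strategy for the statistics `s`: a map that sends a vector of reals to a
probability distribution on `ℝ`, such that every vector of values of the statistics (that is, every
vector which is attained by some distribution) is sent to a distribution having those values. -/
structure ImputationStrategy {K : ℕ} (s : Fin K → Statistic) where
  /-- the imputed distribution -/
  impute : (Fin K → ℝ) → ProbabilityMeasure ℝ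
  /-- the imputed distribution has the prescribed statistics -/
  consistent : ∀ σ : Fin K → ℝ, (∃ μ : ProbabilityMeasure ℝ, ∀ k, s k μ = σ k) →
    ∀ k, s k (impute σ) = σ k

/-- The generalised inverse cumulative distribution function
`F_μ⁻¹(τ) = inf {t | τ ≤ F_μ(t)}`. -/
def quantile (μ : ProbabilityMeasure ℝ) (τ : ℝ) : ℝ :=
  sInf {t : ℝ | τ ≤ cdf (μ : Measure ℝ) t}

/-- The level `(2k - 1) / (2K)`; as the index `k` of type `Fin K` starts at `0`, this reads
`(2 (k + 1) - 1) / (2 K)`. -/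
def level (K : ℕ) (k : Fin K) : ℝ := (2 * ((k : ℝ) + 1) - 1) / (2 * (K : ℝ))

/-- The `K` quantile statistics at the levels `(2k - 1) / (2K)`. -/
def quantileStat (K : ℕ) (k : Fin K) : Statistic := fun μ => quantile μ (level K k)

/-- The uniform mixture of Dirac masses `(1 / K) ∑ₖ δ_{σ k}`, as a measure. -/
def uniformDiracs {K : ℕ} (σ : Fin K → ℝ) : Measure ℝ :=
  ((K : ENNReal)⁻¹) • ∑ k : Fin K, Measure.dirac (σ k)

lemma isProbabilityMeasure_uniformDiracs {K : ℕ} [NeZero K] (σ : Fin K → ℝ) :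
    IsProbabilityMeasure (uniformDiracs σ) := by
  constructor
  have hK : (K : ENNReal) ≠ 0 := by exact_mod_cast NeZero.ne K
  simp [uniformDiracs, ENNReal.inv_mul_cancel hK (ENNReal.natCast_ne_top K)]

/-- The uniform mixture of Dirac masses `(1 / K) ∑ₖ δ_{σ k}`, as a probability distribution. -/
def uniformMixture {K : ℕ} [NeZero K] (σ : Fin K → ℝ) : ProbabilityMeasure ℝ :=
  ⟨uniformDiracs σ, isProbabilityMeasure_uniformDiracs σ⟩

lemma quantile_le_iff (μ : ProbabilityMeasure ℝ) {τ : ℝ} (h0 : 0 < τ) (h1 : τ < 1) (t : ℝ) :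
    quantile μ τ ≤ t ↔ τ ≤ cdf (μ : Measure ℝ) t := by
  set F := cdf (μ : Measure ℝ) with hF
  have hne : {t : ℝ | τ ≤ F t}.Nonempty := by
    obtain ⟨t, ht⟩ := ((tendsto_cdf_atTop (μ : Measure ℝ)).eventually (lt_mem_nhds h1)).exists
    exact ⟨t, ht.le⟩
  obtain ⟨b, hb⟩ := ((tendsto_cdf_atBot (μ : Measure ℝ)).eventually (gt_mem_nhds h0)).exists
  have hbdd : BddBelow {t : ℝ | τ ≤ F t} := by
    refine ⟨b, fun t ht => ?_⟩
    by_contra hlt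
    have := F.mono (not_le.mp hlt).le
    have h2 : τ ≤ F t := ht
    linarith
  constructor
  · intro h
    have key : ∀ u, t < u → τ ≤ F u := by
      intro u hu
      obtain ⟨v, hv, hvu⟩ := exists_lt_of_csInf_lt hne (lt_of_le_of_lt h hu)
      exact le_trans hv (F.mono hvu.le)
    have hcont : Tendsto F (𝓝[>] t) (𝓝 (F t)) :=
      ((F.right_continuous t).mono Set.Ioi_subset_Ici_self).tendsto
    exact ge_of_tendsto hcont (by filter_upwards [self_mem_nhdsWithin] with u hu using key u hu)
  · intro h
    exact csInf_le hbdd h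

lemma level_pos {K : ℕ} (k : Fin K) : 0 < level K k := by
  have hK : (0 : ℝ) < K := by exact_mod_cast k.pos
  have : (0 : ℝ) ≤ (k : ℝ) := by positivity
  unfold level
  exact div_pos (by linarith) (by linarith)

lemma level_lt_one {K : ℕ} (k : Fin K) : level K k < 1 := by
  have hK : (0 : ℝ) < K := by exact_mod_cast k.pos
  have : (k : ℝ) + 1 ≤ K := by exact_mod_cast k.isLt
  unfold level
  rw [div_lt_one (by linarith)]
  linarith

lemma level_mono {K : ℕ} {j k : Fin K} (h : j ≤ k) : level K j ≤ level K k := by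
  have hK : (0 : ℝ) < K := by exact_mod_cast k.pos
  have : (j : ℝ) ≤ (k : ℝ) := by exact_mod_cast h
  unfold level
  gcongr

lemma quantileStat_mono (K : ℕ) (μ : ProbabilityMeasure ℝ) {j k : Fin K} (h : j ≤ k) :
    quantileStat K j μ ≤ quantileStat K k μ := by
  unfold quantileStat
  rw [quantile_le_iff μ (level_pos j) (level_lt_one j)]
  exact (level_mono h).trans
    ((quantile_le_iff μ (level_pos k) (level_lt_one k) _).mp le_rfl)

lemma uniformDiracs_real_Iic {K : ℕ} (σ : Fin K → ℝ) (t : ℝ) :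
    (uniformDiracs σ).real (Set.Iic t) =
      ((Finset.univ.filter fun k : Fin K => σ k ≤ t).card : ℝ) / K := by
  classical
  have : (∑ k : Fin K, Measure.dirac (σ k)) (Set.Iic t) =
      ((Finset.univ.filter fun k : Fin K => σ k ≤ t).card : ENNReal) := by
    simp [Measure.finsetSum_apply, Measure.dirac_apply' _ measurableSet_Iic, Set.indicator_apply]
  simp only [uniformDiracs, Measure.real, Measure.smul_apply, this, smul_eq_mul]
  simp [div_eq_inv_mul]

lemma quantileStat_uniformMixture {K : ℕ} [NeZero K] {σ : Fin K → ℝ} (hσ : Monotone σ)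
    (k : Fin K) :
    quantileStat K k (uniformMixture σ) = σ k := by
  have hK : (0 : ℝ) < K := by exact_mod_cast k.pos
  refine eq_of_forall_ge_iff fun t => ?_
  unfold quantileStat
  rw [quantile_le_iff _ (level_pos k) (level_lt_one k), cdf_eq_real,
    show (uniformMixture σ : Measure ℝ) = uniformDiracs σ from rfl, uniformDiracs_real_Iic, level, div_le_div_iff₀ (by linarith) hK]
  constructor
  · intro h
    by_contra hlt
    have hsub : (Finset.univ.filter fun j : Fin K => σ j ≤ t) ⊆ Finset.Iio k := by
      intro j hj
      have hj' : σ j ≤ t := by simpa using hj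
      rw [Finset.mem_Iio]
      by_contra hkj
      exact hlt ((hσ (not_lt.mp hkj)).trans hj')
    have hc := Finset.card_le_card hsub
    rw [Fin.card_Iio] at hc
    have hc' : ((Finset.univ.filter fun j : Fin K => σ j ≤ t).card : ℝ) ≤ (k : ℝ) := by
      exact_mod_cast hc
    nlinarith
  · intro h
    have hsub : Finset.Iic k ⊆ (Finset.univ.filter fun j : Fin K => σ j ≤ t) := by
      intro j hj
      have : σ j ≤ t := (hσ (Finset.mem_Iic.mp hj)).trans h
      simpa using this
    have hc := Finset.card_le_card hsub
    rw [Fin.card_Iic] at hc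
    have hc' : (k : ℝ) + 1 ≤ ((Finset.univ.filter fun j : Fin K => σ j ≤ t).card : ℝ) := by
      exact_mod_cast hc
    nlinarith

/-- The standard imputation strategy of quantile distributional reinforcement learning:
`σ ↦ (1 / K) ∑ₖ δ_{σ k}`. -/
def quantileImputation (K : ℕ) [NeZero K] : ImputationStrategy (quantileStat K) where
  impute σ := uniformMixture σ
  consistent := by
    rintro σ ⟨μ, hμ⟩ k
    refine quantileStat_uniformMixture (fun i j hij => ?_) k
    rw [← hμ i, ← hμ j]
    exact quantileStat_mono K μ hij

/-! ### Markov decision processes -/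

/-- A Markov decision process with (non-empty) finite state and action spaces, transition kernel
`trans`, discount factor `discount ∈ [0, 1)` and reward distributions `reward`. -/
structure MDP where
  /-- the state space -/
  State : Type u
  /-- the action space -/
  Action : Type v
  [fintypeState : Fintype State]
  [fintypeAction : Fintype Action]
  [nonemptyState : Nonempty State]
  [nonemptyAction : Nonempty Action]
  /-- the transition probabilities -/
  trans : State → Action → PMF State
  /-- the discount factor -/
  discount : ℝ
  discount_nonneg : 0 ≤ discount
  discount_lt_one : discount < 1
  /-- the reward distributions -/
  reward : State → Action → ProbabilityMeasure ℝ

attribute [instance] MDP.fintypeState MDP.fintypeAction MDP.nonemptyState MDP.nonemptyAction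

namespace MDP

/-- A (stationary, Markov) policy. -/
abbrev Policy (M : MDP.{u, v}) : Type (max u v) := M.State → PMF M.Action

instance (M : MDP.{u, v}) : MeasurableSpace M.State := ⊤

instance (M : MDP.{u, v}) : MeasurableSpace M.Action := ⊤

instance (M : MDP.{u, v}) : DiscreteMeasurableSpace M.State := ⟨fun _ => trivial⟩

instance (M : MDP.{u, v}) : DiscreteMeasurableSpace M.Action := ⟨fun _ => trivial⟩

/-- What happens in one time step `t`: the pair `(X_t, A_t)` and the reward `R_t`. -/
abbrev Step (M : MDP.{u, v}) : Type (max u v) := (M.State × M.Action) × ℝ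

/-- Reward distributions, as a kernel. -/
def rewardKernel (M : MDP.{u, v}) : Kernel (M.State × M.Action) ℝ :=
  Kernel.ofFunOfCountable fun z => (M.reward z.1 z.2 : Measure ℝ)

instance (M : MDP.{u, v}) : IsMarkovKernel M.rewardKernel :=
  ⟨fun z => inferInstanceAs (IsProbabilityMeasure (M.reward z.1 z.2 : Measure ℝ))⟩

/-- The law of `(X_{t+1}, A_{t+1})` given `(X_t, A_t)`: the next state is drawn from the transition
probabilities and the next action from the policy at the next state. -/
def pairKernel (M : MDP.{u, v}) (π : M.Policy) : Kernel (M.State × M.Action) (M.State × M.Action) :=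
  Kernel.ofFunOfCountable fun z =>
    ((M.trans z.1 z.2).bind fun x' => (π x').map fun a' => (x', a')).toMeasure

instance (M : MDP.{u, v}) (π : M.Policy) : IsMarkovKernel (M.pairKernel π) :=
  ⟨fun z => PMF.toMeasure.isProbabilityMeasure
    ((M.trans z.1 z.2).bind fun x' => (π x').map fun a' => (x', a'))⟩

/-- The law of `((X_{t+1}, A_{t+1}), R_{t+1})` given `((X_t, A_t), R_t)`. -/
def stepKernel (M : MDP.{u, v}) (π : M.Policy) : Kernel M.Step M.Step :=
  ((M.pairKernel π) ⊗ₖ (Kernel.prodMkLeft (M.State × M.Action) M.rewardKernel)).comap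
    Prod.fst measurable_fst

instance (M : MDP.{u, v}) (π : M.Policy) : IsMarkovKernel (M.stepKernel π) := by
  unfold stepKernel; infer_instance

/-- The law of the next step given the whole history up to time `n` (it depends on the last step
only). -/
def historyKernel (M : MDP.{u, v}) (π : M.Policy) (n : ℕ) :
    Kernel (∀ _ : Finset.Iic n, M.Step) M.Step :=
  (M.stepKernel π).comap (fun h => h ⟨n, Finset.mem_Iic.mpr le_rfl⟩) (measurable_pi_apply _)

instance (M : MDP.{u, v}) (π : M.Policy) (n : ℕ) : IsMarkovKernel (M.historyKernel π n) := by
  unfold historyKernel; infer_instance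

/-- The law of the first step `((X_0, A_0), R_0)` when `X_0 = x` and `A_0 = a`. -/
def initial (M : MDP.{u, v}) (x : M.State) (a : M.Action) : Measure M.Step :=
  (Measure.dirac (x, a)) ⊗ₘ M.rewardKernel

instance (M : MDP.{u, v}) (x : M.State) (a : M.Action) : IsProbabilityMeasure (M.initial x a) := by
  unfold initial; infer_instance

/-- The law of the trajectory `((X_t, A_t), R_t)_{t ≥ 0}` started from `X_0 = x`, `A_0 = a`, when
actions are selected according to `π`. -/
def trajectoryLaw (M : MDP.{u, v}) (π : M.Policy) (x : M.State) (a : M.Action) :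
    Measure (ℕ → M.Step) :=
  Kernel.trajMeasure (X := fun _ => M.Step) (M.initial x a) (M.historyKernel π)

instance (M : MDP.{u, v}) (π : M.Policy) (x : M.State) (a : M.Action) :
    IsProbabilityMeasure (M.trajectoryLaw π x a) := by
  unfold trajectoryLaw; infer_instance

/-- The discounted return `∑_t γ^t R_t` of a trajectory. -/
def discountedReturn (M : MDP.{u, v}) (ω : ℕ → M.Step) : ℝ := ∑' t : ℕ, M.discount ^ t * (ω t).2

lemma measurable_discountedReturn (M : MDP.{u, v}) : Measurable M.discountedReturn := by
  let f : ℕ → (ℕ → M.Step) → ℝ := fun t ω => M.discount ^ t * (ω t).2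
  have hf : ∀ t, Measurable (f t) := fun t => by fun_prop
  let S : Set (ℕ → M.Step) := {ω | Summable fun t => f t ω}
  have hS : MeasurableSet S := by
    have : S = {ω | (∑' t, ‖f t ω‖ₑ) < ⊤} := by
      ext ω
      change Summable (fun t => f t ω) ↔ (∑' t, ‖f t ω‖ₑ) < ⊤
      rw [← summable_norm_iff, lt_top_iff_ne_top]
      exact (ENNReal.tsum_coe_ne_top_iff_summable_coe (f := fun t => ‖f t ω‖₊)).symm
    rw [this]
    exact measurableSet_lt (Measurable.tsum fun t => (hf t).enorm) measurable_const
  have hlim : ∀ ω, Tendsto (fun n => ∑ t ∈ Finset.range n, S.indicator (f t) ω) atTop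
      (𝓝 (M.discountedReturn ω)) := by
    intro ω
    by_cases h : ω ∈ S
    · simp only [Set.indicator_of_mem h]
      exact (show Summable (fun t => f t ω) from h).hasSum.tendsto_sum_nat
    · simp only [Set.indicator_of_notMem h, Finset.sum_const_zero]
      have : M.discountedReturn ω = 0 := tsum_eq_zero_of_not_summable h
      rw [this]
      exact tendsto_const_nhds
  exact measurable_of_tendsto_metrizable
    (fun n => Finset.measurable_sum _ fun t _ => (hf t).indicator hS) (tendsto_pi_nhds.mpr hlim)

/-- The return distribution: the law of `∑_t γ^t R_t` given `X_0 = x`, `A_0 = a`. -/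
def returnDist (M : MDP.{u, v}) (π : M.Policy) (x : M.State) (a : M.Action) : ProbabilityMeasure ℝ :=
  ⟨(M.trajectoryLaw π x a).map M.discountedReturn,
    Measure.isProbabilityMeasure_map M.measurable_discountedReturn.aemeasurable⟩

/-- The mixture over `R_0`, `X_1`, `A_1` (given `X_0 = x`, `A_0 = a`) of the pushforwards of
`η X_1 A_1` under `z ↦ R_0 + γ z`, as a measure. -/
def bellmanMeasure (M : MDP.{u, v}) (π : M.Policy) (η : M.State → M.Action → ProbabilityMeasure ℝ)
    (x : M.State) (a : M.Action) : Measure ℝ :=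
  (M.reward x a : Measure ℝ).bind fun r =>
    ∑ x' : M.State, ∑ a' : M.Action,
      (M.trans x a x' * π x' a') • (η x' a' : Measure ℝ).map fun z => r + M.discount * z

lemma measurable_bellman_integrand (M : MDP.{u, v}) (π : M.Policy)
    (η : M.State → M.Action → ProbabilityMeasure ℝ) (x : M.State) (a : M.Action) :
    Measurable fun r : ℝ => ∑ x' : M.State, ∑ a' : M.Action,
      (M.trans x a x' * π x' a') • (η x' a' : Measure ℝ).map fun z => r + M.discount * z := by
  refine Measure.measurable_of_measurable_coe _ fun s hs => ?_
  simp only [Measure.finsetSum_apply, Measure.smul_apply, smul_eq_mul]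
  refine Finset.measurable_sum _ fun x' _ => Finset.measurable_sum _ fun a' _ => ?_
  refine Measurable.const_mul ?_ _
  have : (fun r : ℝ => ((η x' a' : Measure ℝ).map fun z => r + M.discount * z) s) =
      fun r => (η x' a' : Measure ℝ)
        (Prod.mk r ⁻¹' ((fun q : ℝ × ℝ => q.1 + M.discount * q.2) ⁻¹' s)) := by
    funext r
    rw [Measure.map_apply (by fun_prop) hs]
    rfl
  rw [this]
  exact measurable_measure_prodMk_left ((by fun_prop :
    Measurable fun q : ℝ × ℝ => q.1 + M.discount * q.2) hs)

lemma isProbabilityMeasure_bellmanMeasure (M : MDP.{u, v}) (π : M.Policy)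
    (η : M.State → M.Action → ProbabilityMeasure ℝ) (x : M.State) (a : M.Action) :
    IsProbabilityMeasure (M.bellmanMeasure π η x a) := by
  refine isProbabilityMeasure_bind (M.measurable_bellman_integrand π η x a).aemeasurable
    (ae_of_all _ fun r => ⟨?_⟩)
  have h1 : ∀ x' a', ((η x' a' : Measure ℝ).map fun z => r + M.discount * z) Set.univ = 1 := by
    intro x' a'
    rw [Measure.map_apply (by fun_prop) MeasurableSet.univ]
    simp
  have h2 : ∀ x', ∑ a', π x' a' = 1 := fun x' => by
    rw [← tsum_fintype (L := .unconditional _)]; exact (π x').tsum_coe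
  have h3 : ∑ x', M.trans x a x' = 1 := by
    rw [← tsum_fintype (L := .unconditional _)]; exact (M.trans x a).tsum_coe
  simp only [Measure.finsetSum_apply, Measure.smul_apply, smul_eq_mul, h1, mul_one,
    ← Finset.mul_sum, h2, h3]

/-- The distributional Bellman operator
`(T^π η)(x, a) = E_π[(f_{R_0, γ})_# η(X_1, A_1) | X_0 = x, A_0 = a]`, `f_{r, γ}(z) = r + γ z`. -/
def bellman (M : MDP.{u, v}) (π : M.Policy) (η : M.State → M.Action → ProbabilityMeasure ℝ)
    (x : M.State) (a : M.Action) : ProbabilityMeasure ℝ :=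
  ⟨M.bellmanMeasure π η x a, M.isProbabilityMeasure_bellmanMeasure π η x a⟩

/-! ### Learnt statistics and approximate Bellman closedness -/

/-- One sweep of the dynamic programming algorithm for the statistics `s` with the imputation
strategy `Ψ`: impute distributions from the current estimates, apply the distributional Bellman
operator, and evaluate the statistics. -/
def update (M : MDP.{u, v}) (π : M.Policy) {K : ℕ} (s : Fin K → Statistic) (Ψ : ImputationStrategy s)
    (σ : M.State → M.Action → Fin K → ℝ) : M.State → M.Action → Fin K → ℝ :=
  fun x a k => s k (M.bellman π (fun x' a' => Ψ.impute (σ x' a')) x a)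

/-- `σ` is the table of learnt values of the statistics: it is a fixed point of the dynamic
programming update, and the iterates of the update converge to it from every initialisation
(so there is at most one such `σ`, and it is the only fixed point). -/
structure IsLearnt (M : MDP.{u, v}) (π : M.Policy) {K : ℕ} (s : Fin K → Statistic)
    (Ψ : ImputationStrategy s) (σ : M.State → M.Action → Fin K → ℝ) : Prop where
  isFixedPt : Function.IsFixedPt (M.update π s Ψ) σ
  tendsto_iterate : ∀ σ₀ : M.State → M.Action → Fin K → ℝ,
    Tendsto (fun n => (M.update π s Ψ)^[n] σ₀) atTop (𝓝 σ)

end MDP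

/-- The statistics `s 0, …, s (K - 1)` with the imputation strategy `Ψ` are `ε`-approximately
Bellman closed for the class `𝓜` of MDPs: for each MDP of the class and each policy, there are
learnt values of the statistics, and their average distance to the statistics of the return
distributions is at most `ε`, uniformly in the state-action pair. -/
def ApproxBellmanClosed {K : ℕ} (s : Fin K → Statistic) (Ψ : ImputationStrategy s)
    (𝓜 : Set MDP.{u, v}) (ε : ℝ) : Prop :=
  ∀ M ∈ 𝓜, ∀ π : M.Policy, ∃ σ : M.State → M.Action → Fin K → ℝ, M.IsLearnt π s Ψ σ ∧
    (⨆ z : M.State × M.Action,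
      (1 / (K : ℝ)) * ∑ k : Fin K, |s k (M.returnDist π z.1 z.2) - σ z.1 z.2 k|) ≤ ε

/-- The class of MDPs with discount factor `γ` and immediate reward distributions supported on
`[-Rmax, Rmax]`. -/
def boundedRewardMDPs (γ Rmax : ℝ) : Set MDP.{u, v} :=
  {M | M.discount = γ ∧
    ∀ x a, ∀ᵐ r ∂(M.reward x a : Measure ℝ), r ∈ Set.Icc (-Rmax) Rmax}

end DistRL

end

/-! Distributions are compared by the `L¹` distance of their distribution functions (`cdfDist`, the
Wasserstein-1 distance), and tables of distributions by its supremum over state-action pairs. Put `B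
= R / (1 - γ)`. Four facts carry the proof.

Projection: replacing a law on `[-B, B]` by the uniform mixture on its `K` midpoint quantiles moves
its distribution function by at most `1 / (2K)`, hence moves the law by at most `B / K`
(`cdfDist_uniformDiracs_quantileStat_le`). Contraction: the Bellman operator contracts by `γ`
(`cdfDist_bellman_le`). Sampling: its iterates on the zero return are the laws of the truncated
returns, which converge to the return distribution (`map_partialReturn_trajectoryLaw`). Averages:
for sorted vectors, the average distance of the entries is at most the distance of the mixtures
(`ofReal_average_le_cdfDist_uniformDiracs`).

The update itself is a `γ`-contraction in the sup norm on tables, so Banach's theorem gives the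
learnt table. Its imputed distributions are moved by the Bellman operator by at most `B / K`, hence
lie within `B / (K (1 - γ))` of the return distributions. Projecting the latter costs another `B /
K`. The total, `R (2 - γ) / ((1 - γ)² K)`, is below the claimed bound. -/

noncomputable section

namespace DistRL

/-! ### The `L¹` distance between distribution functions -/

/-- The `L¹` distance between the distribution functions of two measures on the line. -/
def cdfDist (μ ν : Measure ℝ) : ENNReal :=
  ∫⁻ t, edist (μ.real (Set.Iic t)) (ν.real (Set.Iic t))

lemma measurable_real_Iic (μ : Measure ℝ) [IsFiniteMeasure μ] :
    Measurable fun t => μ.real (Set.Iic t) :=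
  Monotone.measurable fun _ _ h => measureReal_mono (Set.Iic_subset_Iic.mpr h)

lemma cdfDist_comm (μ ν : Measure ℝ) : cdfDist μ ν = cdfDist ν μ := by
  simp only [cdfDist, edist_comm]

lemma cdfDist_triangle (μ ν ρ : Measure ℝ) [IsFiniteMeasure μ] [IsFiniteMeasure ν] :
    cdfDist μ ρ ≤ cdfDist μ ν + cdfDist ν ρ := by
  unfold cdfDist
  rw [← lintegral_add_left ((measurable_real_Iic μ).edist (measurable_real_Iic ν))]
  exact lintegral_mono fun t => edist_triangle _ _ _

lemma measurable_kernel_real_Iic {α : Type*} [MeasurableSpace α] (κ : Kernel α ℝ)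
    [IsMarkovKernel κ] : Measurable fun p : α × ℝ => (κ p.1).real (Set.Iic p.2) := by
  have hs : MeasurableSet {q : (α × ℝ) × ℝ | q.2 ≤ q.1.2} :=
    measurableSet_le (by fun_prop) (by fun_prop)
  exact (Kernel.measurable_kernel_prodMk_left (κ := Kernel.prodMkRight ℝ κ) hs).ennreal_toReal

lemma comp_real_Iic {α : Type*} [MeasurableSpace α] (μ : Measure α) [IsProbabilityMeasure μ]
    (κ : Kernel α ℝ) [IsMarkovKernel κ] (t : ℝ) :
    (κ ∘ₘ μ).real (Set.Iic t) = ∫ x, (κ x).real (Set.Iic t) ∂μ := by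
  simp only [Measure.real]
  rw [Measure.bind_apply measurableSet_Iic (Kernel.aemeasurable _), integral_toReal]
  · exact (Kernel.measurable_coe κ measurableSet_Iic).aemeasurable
  · exact ae_of_all _ fun x => measure_lt_top _ _

/-- The distance of two mixtures is at most the average distance of the components. -/
lemma cdfDist_comp_le {α : Type*} [MeasurableSpace α] (μ : Measure α) [IsProbabilityMeasure μ]
    (κ κ' : Kernel α ℝ) [IsMarkovKernel κ] [IsMarkovKernel κ'] :
    cdfDist (κ ∘ₘ μ) (κ' ∘ₘ μ) ≤ ∫⁻ x, cdfDist (κ x) (κ' x) ∂μ := by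
  have hint : ∀ (κ : Kernel α ℝ) [IsMarkovKernel κ] (t : ℝ),
      Integrable (fun x => (κ x).real (Set.Iic t)) μ := fun κ _ t =>
    Integrable.of_bound (C := 1)
      ((Kernel.measurable_coe κ measurableSet_Iic).ennreal_toReal).aestronglyMeasurable
      (ae_of_all _ fun x => by
        rw [Real.norm_of_nonneg measureReal_nonneg]; exact measureReal_le_one)
  unfold cdfDist
  rw [lintegral_lintegral_swap]
  · refine lintegral_mono fun t => ?_
    rw [comp_real_Iic, comp_real_Iic, edist_eq_enorm_sub, ← integral_sub (hint κ t) (hint κ' t)]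
    simp only [edist_eq_enorm_sub]
    exact enorm_integral_le_lintegral_enorm _
  · exact ((measurable_kernel_real_Iic κ).edist (measurable_kernel_real_Iic κ')).aemeasurable

/-- The two indicators, which are the distribution functions of Dirac masses, differ by `1` exactly
on the half-open interval between `a` and `b`. -/
lemma lintegral_edist_indicator_Ici (a b : ℝ) :
    ∫⁻ t, edist ((Set.Ici a).indicator (1 : ℝ → ℝ) t) ((Set.Ici b).indicator 1 t) = edist a b := by
  wlog hab : a ≤ b generalizing a b
  · simpa only [edist_comm] using this b a (le_of_not_ge hab)
  have : (fun t => edist ((Set.Ici a).indicator (1 : ℝ → ℝ) t) ((Set.Ici b).indicator 1 t)) =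
      (Set.Ico a b).indicator 1 := by
    funext t
    by_cases h1 : a ≤ t <;> by_cases h2 : b ≤ t
    · simp [h1, h2]
    · simp [h1, h2, edist_dist, not_le.mp h2]
    · exact absurd (hab.trans h2) h1
    · simp [h1, h2]
  rw [this, lintegral_indicator_one measurableSet_Ico, Real.volume_Ico, edist_dist, dist_comm,
    Real.dist_eq, abs_of_nonneg (sub_nonneg.mpr hab)]

lemma dirac_real_Iic (a t : ℝ) :
    (Measure.dirac a).real (Set.Iic t) = (Set.Ici a).indicator (1 : ℝ → ℝ) t := by
  by_cases h : a ≤ t <;> simp [measureReal_def, h, Measure.dirac_apply' _ measurableSet_Iic]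

lemma cdfDist_dirac (a b : ℝ) : cdfDist (Measure.dirac a) (Measure.dirac b) = edist a b := by
  simp only [cdfDist, dirac_real_Iic, lintegral_edist_indicator_Ici]

/-- A coupling bound: both image laws are mixtures over the same `μ` of Dirac masses, at `f x` and
`g x`. -/
lemma cdfDist_map_le {α : Type*} [MeasurableSpace α] (μ : Measure α) [IsProbabilityMeasure μ]
    {f g : α → ℝ} (hf : Measurable f) (hg : Measurable g) :
    cdfDist (μ.map f) (μ.map g) ≤ ∫⁻ x, edist (f x) (g x) ∂μ := by
  rw [← Measure.deterministic_comp_eq_map hf, ← Measure.deterministic_comp_eq_map hg]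
  refine (cdfDist_comp_le μ _ _).trans_eq ?_
  simp only [Kernel.deterministic_apply, cdfDist_dirac]

lemma cdfDist_map_affine {c : ℝ} (hc : 0 ≤ c) (r : ℝ) (μ ν : Measure ℝ) [IsProbabilityMeasure μ]
    [IsProbabilityMeasure ν] :
    cdfDist (μ.map fun y => r + c * y) (ν.map fun y => r + c * y) =
      ENNReal.ofReal c * cdfDist μ ν := by
  have hm : Measurable fun y : ℝ => r + c * y := by fun_prop
  unfold cdfDist
  simp only [map_measureReal_apply hm measurableSet_Iic]
  -- For `c = 0` both images are the Dirac mass at `r`. Otherwise the substitution `t = r + c * s`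
  -- produces the factor `c`.
  rcases hc.eq_or_lt with rfl | hc
  · have : ∀ t : ℝ, μ.real ((fun y => r + 0 * y) ⁻¹' Set.Iic t) =
        ν.real ((fun y => r + 0 * y) ⁻¹' Set.Iic t) := fun t => by
      by_cases h : r ≤ t <;> simp [Set.preimage, h]
    rw [ENNReal.ofReal_zero, zero_mul, lintegral_congr fun t => by rw [this t, edist_self],
      lintegral_zero]
  · have hpre : ∀ s : ℝ, (fun y => r + c * y) ⁻¹' Set.Iic (r + c * s) = Set.Iic s := fun s => by
      ext y; simp [hc]
    rw [← lintegral_add_left_eq_self _ r]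
    nth_rewrite 1 [← Real.smul_map_volume_mul_left hc.ne']
    rw [lintegral_smul_measure, abs_of_pos hc, smul_eq_mul,
      show (fun x : ℝ => c * x) = MeasurableEquiv.mulLeft₀ c hc.ne' from rfl, lintegral_map_equiv]
    simp only [MeasurableEquiv.coe_mulLeft₀, hpre]

/-- `μ` is carried by `[-B, B]`. -/
def SupportedOn (B : ℝ) (μ : Measure ℝ) : Prop := ∀ᵐ y ∂μ, y ∈ Set.Icc (-B) B

lemma SupportedOn.real_Iic_of_lt {B : ℝ} {μ : Measure ℝ} (h : SupportedOn B μ) {t : ℝ}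
    (ht : t < -B) : μ.real (Set.Iic t) = 0 := by
  rw [measureReal_def, measure_eq_zero_iff_ae_notMem.mpr, ENNReal.toReal_zero]
  filter_upwards [h] with y hy hyt
  exact absurd (hy.1.trans hyt) (not_le.mpr ht)

lemma SupportedOn.real_Iic_of_le {B : ℝ} {μ : Measure ℝ} [IsProbabilityMeasure μ]
    (h : SupportedOn B μ) {t : ℝ} (ht : B ≤ t) : μ.real (Set.Iic t) = 1 := by
  have : μ (Set.Iic t) = 1 := by
    rw [← mem_ae_iff_prob_eq_one measurableSet_Iic]
    filter_upwards [h] with y hy using hy.2.trans ht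
  simp [measureReal_def, this]

/-- Outside `[-B, B)` both distribution functions are `0` or both are `1`, so the integrand lives on
an interval of length `2 * B`. -/
lemma cdfDist_le_of_supportedOn {B ε : ℝ} {μ ν : Measure ℝ} [IsProbabilityMeasure μ]
    [IsProbabilityMeasure ν] (hμ : SupportedOn B μ) (hν : SupportedOn B ν)
    (h : ∀ t, |μ.real (Set.Iic t) - ν.real (Set.Iic t)| ≤ ε) :
    cdfDist μ ν ≤ ENNReal.ofReal (2 * B * ε) := by
  have hε : 0 ≤ ε := (abs_nonneg _).trans (h 0)
  calc cdfDist μ ν ≤ ∫⁻ t, (Set.Ico (-B) B).indicator (fun _ => ENNReal.ofReal ε) t := by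
        refine lintegral_mono fun t => ?_
        by_cases ht : t ∈ Set.Ico (-B) B
        · rw [Set.indicator_of_mem ht, edist_dist, Real.dist_eq]
          exact ENNReal.ofReal_le_ofReal (h t)
        · rw [Set.indicator_of_notMem ht]
          rcases lt_or_ge t (-B) with h1 | h1
          · simp [hμ.real_Iic_of_lt h1, hν.real_Iic_of_lt h1]
          · have h2 : B ≤ t := not_lt.mp fun h2 => ht ⟨h1, h2⟩
            simp [hμ.real_Iic_of_le h2, hν.real_Iic_of_le h2]
    _ = ENNReal.ofReal (2 * B * ε) := by
        rw [lintegral_indicator_const measurableSet_Ico, Real.volume_Ico,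
          ← ENNReal.ofReal_mul hε]
        congr 1; ring

/-! ### Quantile statistics -/

lemma SupportedOn.abs_quantile_le {B : ℝ} {μ : ProbabilityMeasure ℝ}
    (h : SupportedOn B (μ : Measure ℝ)) {τ : ℝ} (h0 : 0 < τ) (h1 : τ < 1) :
    |quantile μ τ| ≤ B := by
  rw [abs_le]
  constructor
  · by_contra! hlt
    have := (quantile_le_iff μ h0 h1 _).mp le_rfl
    rw [cdf_eq_real, h.real_Iic_of_lt hlt] at this
    linarith
  · rw [quantile_le_iff μ h0 h1, cdf_eq_real, h.real_Iic_of_le le_rfl]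
    exact h1.le

/-- The condition `level K k ≤ p` reads `k + 1 ≤ K * p + 1 / 2`, so the count is `K * p` rounded to
a nearest integer. This is where the choice of midpoint levels yields `1 / (2 * K)`. -/
lemma abs_card_filter_level_sub_le {K : ℕ} [NeZero K] {p : ℝ} (h0 : 0 ≤ p) (h1 : p ≤ 1) :
    |((Finset.univ.filter fun k : Fin K => level K k ≤ p).card : ℝ) / K - p| ≤ 1 / (2 * K) := by
  have hK : (0 : ℝ) < K := by exact_mod_cast Nat.pos_of_neZero K
  have hx : 0 ≤ K * p + 1 / 2 := by positivity
  set m := ⌊(K : ℝ) * p + 1 / 2⌋₊ with hm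
  have hmK : m ≤ K := by
    rw [← Nat.lt_succ_iff, hm, Nat.floor_lt hx]
    push_cast
    nlinarith
  have hiff : ∀ k : Fin K, level K k ≤ p ↔ (k : ℕ) < m := fun k => by
    rw [← Nat.succ_le_iff, hm, Nat.le_floor_iff hx, level, div_le_iff₀ (by linarith)]
    push_cast
    constructor <;> intro h <;> linarith
  have hcard : (Finset.univ.filter fun k : Fin K => level K k ≤ p).card = m := by
    simp only [hiff]
    rw [Fin.card_filter_val_lt, min_eq_right hmK]
  have h2 := Nat.floor_le hx
  have h3 := Nat.lt_floor_add_one ((K : ℝ) * p + 1 / 2)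
  rw [← hm] at h2 h3
  have h4 : (m : ℝ) / K - p = (m - K * p) / K := by field_simp
  rw [hcard, h4, abs_div, abs_of_pos hK, div_le_div_iff₀ hK (by linarith)]
  have : |(m : ℝ) - K * p| ≤ 1 / 2 := abs_le.mpr ⟨by linarith, by linarith⟩
  nlinarith

/-- By `quantile_le_iff`, the imputed distribution function at `t` is the proportion of levels that
are at most `F_μ(t)`. -/
lemma abs_uniformDiracs_quantileStat_sub_le {K : ℕ} [NeZero K] (μ : ProbabilityMeasure ℝ)
    (t : ℝ) :
    |(uniformDiracs fun k => quantileStat K k μ).real (Set.Iic t) -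
      (μ : Measure ℝ).real (Set.Iic t)| ≤ 1 / (2 * K) := by
  have : ∀ k : Fin K, quantileStat K k μ ≤ t ↔ level K k ≤ (μ : Measure ℝ).real (Set.Iic t) :=
    fun k => by
      rw [quantileStat, quantile_le_iff μ (level_pos k) (level_lt_one k), cdf_eq_real]
  rw [uniformDiracs_real_Iic]
  simp only [this]
  exact abs_card_filter_level_sub_le measureReal_nonneg measureReal_le_one

lemma supportedOn_uniformDiracs {K : ℕ} {B : ℝ} {σ : Fin K → ℝ} (h : ∀ k, |σ k| ≤ B) :
    SupportedOn B (uniformDiracs σ) := by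
  have hs : MeasurableSet (Set.Icc (-B) B)ᶜ := measurableSet_Icc.compl
  change uniformDiracs σ (Set.Icc (-B) B)ᶜ = 0
  simp only [uniformDiracs, Measure.smul_apply, Measure.finsetSum_apply,
    Measure.dirac_apply' _ hs]
  simp [fun k => abs_le.mp (h k)]

/-- Replacing a distribution by the one imputed from its `K` quantiles is a small change. -/
lemma cdfDist_uniformDiracs_quantileStat_le {K : ℕ} [NeZero K] {B : ℝ} {μ : ProbabilityMeasure ℝ}
    (h : SupportedOn B (μ : Measure ℝ)) :
    cdfDist (uniformDiracs fun k => quantileStat K k μ) μ ≤ ENNReal.ofReal (B / K) := by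
  have := isProbabilityMeasure_uniformDiracs fun k => quantileStat K k μ
  refine (cdfDist_le_of_supportedOn (supportedOn_uniformDiracs
    (σ := fun k => quantileStat K k μ) fun k => h.abs_quantile_le (level_pos k) (level_lt_one k)) h
    (abs_uniformDiracs_quantileStat_sub_le μ)).trans_eq ?_
  congr 1
  have hK : (K : ℝ) ≠ 0 := by exact_mod_cast NeZero.ne K
  field_simp

lemma uniformDiracs_real_Iic_eq_sum {K : ℕ} (σ : Fin K → ℝ) (t : ℝ) :
    (uniformDiracs σ).real (Set.Iic t) =
      (1 / (K : ℝ)) * ∑ k, (Set.Ici (σ k)).indicator (1 : ℝ → ℝ) t := by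
  rw [uniformDiracs_real_Iic, Finset.card_filter]
  push_cast
  simp only [Set.indicator_apply, Set.mem_Ici, Pi.one_apply]
  ring

/-- For nondecreasing vectors, the average distance of the entries is at most the distance of the
imputed distributions. -/
lemma ofReal_average_le_cdfDist_uniformDiracs {K : ℕ} {σ σ' : Fin K → ℝ} (hσ : Monotone σ)
    (hσ' : Monotone σ') :
    ENNReal.ofReal ((1 / (K : ℝ)) * ∑ k, |σ k - σ' k|) ≤
      cdfDist (uniformDiracs σ) (uniformDiracs σ') := by
  set I : ℝ → ℝ → ℝ := fun a t => (Set.Ici a).indicator (1 : ℝ → ℝ) t with hI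
  have hanti : ∀ {a b t : ℝ}, a ≤ b → I b t ≤ I a t := fun {a b t} hab =>
    Set.indicator_le_indicator_of_subset (Set.Ici_subset_Ici.mpr hab) (by simp) t
  have h01 : ∀ a t, I a t = 0 ∨ I a t = 1 := fun a t => by
    by_cases h : a ≤ t <;> simp [hI, h]
  -- For fixed `t`, the indices with `σ k ≤ t` and those with `σ' k ≤ t` are both initial segments,
  -- hence nested. All the differences thus have the same sign and nothing cancels in the sum.
  have hsum : ∀ t, |∑ k, (I (σ k) t - I (σ' k) t)| = ∑ k, |I (σ k) t - I (σ' k) t| := by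
    intro t
    by_cases hle : ∀ k, I (σ k) t ≤ I (σ' k) t
    · rw [abs_of_nonpos (Finset.sum_nonpos fun k _ => sub_nonpos.mpr (hle k)),
        ← Finset.sum_neg_distrib]
      exact Finset.sum_congr rfl fun k _ => (abs_of_nonpos (sub_nonpos.mpr (hle k))).symm
    · push Not at hle
      obtain ⟨j, hj⟩ := hle
      -- Here `σ j ≤ t < σ' j`. Monotonicity gives `t < σ' k` for `k ≥ j` and `σ k ≤ t` for `k ≤ j`.
      have hge : ∀ k, I (σ' k) t ≤ I (σ k) t := fun k => by
        rcases le_total j k with hjk | hjk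
        · have := hanti (t := t) (hσ' hjk)
          rcases h01 (σ k) t with h1 | h1 <;> rcases h01 (σ' k) t with h2 | h2 <;>
          rcases h01 (σ j) t with h3 | h3 <;> rcases h01 (σ' j) t with h4 | h4 <;> linarith
        · have := hanti (t := t) (hσ hjk)
          rcases h01 (σ k) t with h1 | h1 <;> rcases h01 (σ' k) t with h2 | h2 <;>
          rcases h01 (σ j) t with h3 | h3 <;> rcases h01 (σ' j) t with h4 | h4 <;> linarith
      rw [abs_of_nonneg (Finset.sum_nonneg fun k _ => sub_nonneg.mpr (hge k))]
      exact Finset.sum_congr rfl fun k _ => (abs_of_nonneg (sub_nonneg.mpr (hge k))).symm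
  have hmeas : ∀ a, Measurable (I a) := fun a =>
    (measurable_const (a := (1 : ℝ))).indicator measurableSet_Ici
  have hK : (0 : ℝ) ≤ 1 / K := by positivity
  have key : ∀ t, edist ((uniformDiracs σ).real (Set.Iic t)) ((uniformDiracs σ').real (Set.Iic t)) =
      ENNReal.ofReal (1 / K) * ∑ k, edist (I (σ k) t) (I (σ' k) t) := fun t => by
    rw [uniformDiracs_real_Iic_eq_sum, uniformDiracs_real_Iic_eq_sum, edist_dist, Real.dist_eq,
      ← mul_sub, ← Finset.sum_sub_distrib, abs_mul, abs_of_nonneg hK, hsum,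
      ENNReal.ofReal_mul hK, ENNReal.ofReal_sum_of_nonneg fun _ _ => abs_nonneg _]
    simp only [edist_dist, Real.dist_eq]
  unfold cdfDist
  simp only [key]
  rw [lintegral_const_mul _ (Finset.measurable_sum _ fun k _ => (hmeas _).edist (hmeas _)),
    lintegral_finsetSum _ fun k _ => (hmeas _).edist (hmeas _)]
  simp only [hI, lintegral_edist_indicator_Ici]
  rw [ENNReal.ofReal_mul hK, ENNReal.ofReal_sum_of_nonneg fun _ _ => abs_nonneg _]
  simp only [edist_dist, Real.dist_eq]
  exact le_rfl

namespace MDP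

/-! ### The distributional Bellman operator -/

lemma pairKernel_singleton (M : MDP.{u, v}) (π : M.Policy) (z z' : M.State × M.Action) :
    M.pairKernel π z {z'} = M.trans z.1 z.2 z'.1 * π z'.1 z'.2 := by
  classical
  change (PMF.toMeasure _) {z'} = _
  rw [PMF.toMeasure_apply_singleton _ _ (measurableSet_singleton z'), PMF.bind_apply,
    tsum_eq_single z'.1]
  · rw [PMF.map_apply, tsum_eq_single z'.2]
    · simp
    · intro a' ha'
      rw [if_neg]
      exact fun h => ha' (by rw [h])
  · intro x' hx'
    rw [PMF.map_apply, ENNReal.tsum_eq_zero.mpr, mul_zero]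
    intro a'
    rw [if_neg]
    exact fun h => hx' (by rw [h])

lemma lintegral_pairKernel (M : MDP.{u, v}) (π : M.Policy) (z : M.State × M.Action)
    (f : M.State × M.Action → ENNReal) :
    ∫⁻ z', f z' ∂M.pairKernel π z =
      ∑ x', ∑ a', (M.trans z.1 z.2 x' * π x' a') * f (x', a') := by
  rw [lintegral_fintype, Fintype.sum_prod_type]
  simp only [pairKernel_singleton, mul_comm]

/-- A table of return distributions, as a kernel. -/
def tableKernel (M : MDP.{u, v}) (η : M.State → M.Action → ProbabilityMeasure ℝ) :
    Kernel (M.State × M.Action) ℝ :=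
  Kernel.ofFunOfCountable fun z => (η z.1 z.2 : Measure ℝ)

instance (M : MDP.{u, v}) (η : M.State → M.Action → ProbabilityMeasure ℝ) :
    IsMarkovKernel (M.tableKernel η) :=
  ⟨fun z => inferInstanceAs (IsProbabilityMeasure (η z.1 z.2 : Measure ℝ))⟩

/-- The law of `r + γ Z` with `Z` drawn from `η z`, as a kernel in `(r, z)`. -/
def backupKernel (M : MDP.{u, v}) (η : M.State → M.Action → ProbabilityMeasure ℝ) :
    Kernel (ℝ × (M.State × M.Action)) ℝ :=
  (Kernel.deterministic Prod.fst measurable_fst ×ₖ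
    (M.tableKernel η).comap Prod.snd measurable_snd).map fun p => p.1 + M.discount * p.2

instance (M : MDP.{u, v}) (η : M.State → M.Action → ProbabilityMeasure ℝ) :
    IsMarkovKernel (M.backupKernel η) :=
  Kernel.IsMarkovKernel.map _ (by fun_prop)

lemma backupKernel_apply (M : MDP.{u, v}) (η : M.State → M.Action → ProbabilityMeasure ℝ)
    (q : ℝ × (M.State × M.Action)) :
    M.backupKernel η q = (η q.2.1 q.2.2 : Measure ℝ).map fun y => q.1 + M.discount * y := by
  rw [backupKernel, Kernel.map_apply _ (by fun_prop), Kernel.prod_apply,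
    Kernel.deterministic_apply, Kernel.comap_apply, Measure.dirac_prod,
    Measure.map_map (by fun_prop) (by fun_prop)]
  rfl

/-- The law of `(R_0, (X_1, A_1))` given `(X_0, A_0)`. -/
def transition (M : MDP.{u, v}) (π : M.Policy) (x : M.State) (a : M.Action) :
    Measure (ℝ × (M.State × M.Action)) :=
  (M.reward x a : Measure ℝ).prod (M.pairKernel π (x, a))

instance (M : MDP.{u, v}) (π : M.Policy) (x : M.State) (a : M.Action) :
    IsProbabilityMeasure (M.transition π x a) := by
  unfold transition; infer_instance

/-- In this form the mixing measure does not depend on `η`, so two Bellman images can be compared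
component by component through `cdfDist_comp_le`. -/
lemma bellman_eq_comp (M : MDP.{u, v}) (π : M.Policy)
    (η : M.State → M.Action → ProbabilityMeasure ℝ) (x : M.State) (a : M.Action) :
    (M.bellman π η x a : Measure ℝ) = M.backupKernel η ∘ₘ M.transition π x a := by
  ext s hs
  change M.bellmanMeasure π η x a s = _
  rw [bellmanMeasure, Measure.bind_apply hs (M.measurable_bellman_integrand π η x a).aemeasurable,
    Measure.bind_apply hs (Kernel.aemeasurable _), transition,
    lintegral_prod _ (Kernel.measurable_coe _ hs).aemeasurable]
  simp only [lintegral_pairKernel, backupKernel_apply, Measure.finsetSum_apply,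
    Measure.smul_apply, smul_eq_mul]

lemma bellman_apply (M : MDP.{u, v}) (π : M.Policy)
    (η : M.State → M.Action → ProbabilityMeasure ℝ) (x : M.State) (a : M.Action) {s : Set ℝ}
    (hs : MeasurableSet s) :
    (M.bellman π η x a : Measure ℝ) s =
      ∫⁻ q, (η q.2.1 q.2.2 : Measure ℝ) ((fun y => q.1 + M.discount * y) ⁻¹' s)
        ∂M.transition π x a := by
  rw [bellman_eq_comp, Measure.bind_apply hs (Kernel.aemeasurable _)]
  refine lintegral_congr fun q => ?_
  rw [backupKernel_apply, Measure.map_apply (by fun_prop) hs]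

/-- The Bellman operator contracts the `L¹` distance of distribution functions. -/
lemma cdfDist_bellman_le (M : MDP.{u, v}) (π : M.Policy)
    {η η' : M.State → M.Action → ProbabilityMeasure ℝ} {C : ENNReal}
    (h : ∀ x a, cdfDist (η x a) (η' x a) ≤ C) (x : M.State) (a : M.Action) :
    cdfDist (M.bellman π η x a) (M.bellman π η' x a) ≤ ENNReal.ofReal M.discount * C := by
  rw [bellman_eq_comp, bellman_eq_comp]
  refine (cdfDist_comp_le _ _ _).trans ?_
  calc _ ≤ ∫⁻ _, ENNReal.ofReal M.discount * C ∂M.transition π x a := by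
        refine lintegral_mono fun q => ?_
        rw [backupKernel_apply, backupKernel_apply, cdfDist_map_affine M.discount_nonneg]
        gcongr
        exact h _ _
    _ = _ := by simp

lemma ae_transition_fst (M : MDP.{u, v}) (π : M.Policy) (x : M.State) (a : M.Action)
    {p : ℝ → Prop} (h : ∀ᵐ r ∂(M.reward x a : Measure ℝ), p r) :
    ∀ᵐ q ∂M.transition π x a, p q.1 :=
  Measure.quasiMeasurePreserving_fst.ae h

lemma supportedOn_bellman (M : MDP.{u, v}) (π : M.Policy) {R B : ℝ}
    (hR : ∀ x a, SupportedOn R (M.reward x a : Measure ℝ))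
    {η : M.State → M.Action → ProbabilityMeasure ℝ} (h : ∀ x a, SupportedOn B (η x a : Measure ℝ))
    (x : M.State) (a : M.Action) :
    SupportedOn (R + M.discount * B) (M.bellman π η x a : Measure ℝ) := by
  have hs : MeasurableSet (Set.Icc (-(R + M.discount * B)) (R + M.discount * B))ᶜ :=
    measurableSet_Icc.compl
  change (M.bellman π η x a : Measure ℝ) (Set.Icc _ _)ᶜ = 0
  rw [bellman_apply M π η x a hs, lintegral_eq_zero_iff]
  · filter_upwards [M.ae_transition_fst π x a (hR x a)] with q hq
    change (η q.2.1 q.2.2 : Measure ℝ) _ = 0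
    rw [measure_eq_zero_iff_ae_notMem]
    filter_upwards [h q.2.1 q.2.2] with y hy
    have h1 := mul_le_mul_of_nonneg_left hy.1 M.discount_nonneg
    have h2 := mul_le_mul_of_nonneg_left hy.2 M.discount_nonneg
    simp only [Set.mem_preimage, Set.mem_compl_iff, not_not, Set.mem_Icc]
    exact ⟨by linarith [hq.1], by linarith [hq.2]⟩
  · have := Kernel.measurable_coe (M.backupKernel η) hs
    have hm : ∀ r, Measurable fun y => r + M.discount * y := fun r => by fun_prop
    simpa only [backupKernel_apply, Measure.map_apply (hm _) hs] using this

/-- The atoms are compared index by index, so the vectors need not be sorted; this allows arbitrary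
initial tables. -/
lemma uniformDiracs_mono {K : ℕ} {σ σ' : Fin K → ℝ} {s s' : Set ℝ} (hs : MeasurableSet s)
    (hs' : MeasurableSet s') (h : ∀ k, σ k ∈ s → σ' k ∈ s') :
    uniformDiracs σ s ≤ uniformDiracs σ' s' := by
  simp only [uniformDiracs, Measure.smul_apply, Measure.finsetSum_apply,
    Measure.dirac_apply' _ hs, Measure.dirac_apply' _ hs', smul_eq_mul]
  gcongr with k
  by_cases hk : σ k ∈ s
  · simp [hk, h k hk]
  · simp [hk]

/-! ### Convergence of quantile dynamic programming -/

section QuantileUpdate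

variable {K : ℕ} [NeZero K]

/-- The table of distributions imputed from a table of quantiles. -/
def imputed (M : MDP.{u, v}) (σ : M.State → M.Action → Fin K → ℝ) :
    M.State → M.Action → ProbabilityMeasure ℝ :=
  fun x a => uniformMixture (σ x a)

lemma quantileUpdate_apply (M : MDP.{u, v}) (π : M.Policy) (σ : M.State → M.Action → Fin K → ℝ)
    (x : M.State) (a : M.Action) (k : Fin K) :
    M.update π (quantileStat K) (quantileImputation K) σ x a k =
      quantileStat K k (M.bellman π (M.imputed σ) x a) := rfl

/-- If an atom satisfies `r + γ σ' ≤ t`, then `r + γ σ ≤ t + γ d`. The distribution function of the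
image of `σ` at `t + γ d` therefore dominates that of the image of `σ'` at `t`, and quantiles
reverse this order. Used in both directions, this one-sided bound gives the sup-norm contraction. -/
lemma quantileUpdate_le (M : MDP.{u, v}) (π : M.Policy) {σ σ' : M.State → M.Action → Fin K → ℝ}
    {d : ℝ} (h : ∀ x a k, σ x a k ≤ σ' x a k + d) (x : M.State) (a : M.Action) (k : Fin K) :
    M.update π (quantileStat K) (quantileImputation K) σ x a k ≤
      M.update π (quantileStat K) (quantileImputation K) σ' x a k + M.discount * d := by
  simp only [quantileUpdate_apply, quantileStat]
  rw [quantile_le_iff _ (level_pos k) (level_lt_one k), cdf_eq_real]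
  refine ((quantile_le_iff (M.bellman π (M.imputed σ') x a) (level_pos k) (level_lt_one k)
    _).mp le_rfl).trans ?_
  rw [cdf_eq_real]
  refine ENNReal.toReal_mono (measure_ne_top _ _) ?_
  rw [bellman_apply _ _ _ _ _ measurableSet_Iic, bellman_apply _ _ _ _ _ measurableSet_Iic]
  refine lintegral_mono fun q => ?_
  have hm : Measurable fun y => q.1 + M.discount * y := by fun_prop
  refine uniformDiracs_mono (hm measurableSet_Iic) (hm measurableSet_Iic) fun j hj => ?_
  have := mul_le_mul_of_nonneg_left (h q.2.1 q.2.2 j) M.discount_nonneg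
  simp only [Set.mem_preimage, Set.mem_Iic] at hj ⊢
  linarith

lemma dist_quantileUpdate_le (M : MDP.{u, v}) (π : M.Policy)
    (σ σ' : M.State → M.Action → Fin K → ℝ) :
    dist (M.update π (quantileStat K) (quantileImputation K) σ)
      (M.update π (quantileStat K) (quantileImputation K) σ') ≤ M.discount * dist σ σ' := by
  have hd : ∀ x a k, dist (σ x a k) (σ' x a k) ≤ dist σ σ' := fun x a k =>
    ((dist_le_pi_dist _ _ k).trans (dist_le_pi_dist _ _ a)).trans (dist_le_pi_dist σ σ' x)
  have h0 : 0 ≤ M.discount * dist σ σ' := mul_nonneg M.discount_nonneg dist_nonneg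
  refine (dist_pi_le_iff h0).mpr fun x => (dist_pi_le_iff h0).mpr fun a =>
    (dist_pi_le_iff h0).mpr fun k => ?_
  have h1 := M.quantileUpdate_le π (σ := σ) (σ' := σ') (d := dist σ σ')
    (fun x a k => by have := hd x a k; rw [Real.dist_eq, abs_le] at this; linarith) x a k
  have h2 := M.quantileUpdate_le π (σ := σ') (σ' := σ) (d := dist σ σ')
    (fun x a k => by have := hd x a k; rw [Real.dist_eq, abs_le] at this; linarith) x a k
  rw [Real.dist_eq, abs_le]
  constructor <;> linarith

lemma contractingWith_quantileUpdate (M : MDP.{u, v}) (π : M.Policy) :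
    ContractingWith ⟨M.discount, M.discount_nonneg⟩
      (M.update π (quantileStat K) (quantileImputation K)) :=
  ⟨by exact_mod_cast M.discount_lt_one, LipschitzWith.of_dist_le_mul (M.dist_quantileUpdate_le π)⟩

lemma exists_isLearnt_quantileStat (M : MDP.{u, v}) (π : M.Policy) :
    ∃ σ, M.IsLearnt π (quantileStat K) (quantileImputation K) σ :=
  let h := M.contractingWith_quantileUpdate (K := K) π
  ⟨_, h.fixedPoint_isFixedPt, h.tendsto_iterate_fixedPoint⟩

variable {M : MDP.{u, v}} {π : M.Policy} {σ : M.State → M.Action → Fin K → ℝ}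

lemma quantileStat_bellman_of_isFixedPt
    (h : Function.IsFixedPt (M.update π (quantileStat K) (quantileImputation K)) σ)
    (x : M.State) (a : M.Action) (k : Fin K) :
    quantileStat K k (M.bellman π (M.imputed σ) x a) = σ x a k := by
  rw [← quantileUpdate_apply, h]

lemma monotone_of_isFixedPt
    (h : Function.IsFixedPt (M.update π (quantileStat K) (quantileImputation K)) σ)
    (x : M.State) (a : M.Action) : Monotone (σ x a) := fun i j hij => by
  rw [← quantileStat_bellman_of_isFixedPt h, ← quantileStat_bellman_of_isFixedPt h]
  exact quantileStat_mono K _ hij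

/-- The learnt quantiles are bounded by the largest possible return. -/
lemma abs_le_of_isFixedPt {R : ℝ} (hR : ∀ x a, SupportedOn R (M.reward x a : Measure ℝ))
    (h : Function.IsFixedPt (M.update π (quantileStat K) (quantileImputation K)) σ)
    (x : M.State) (a : M.Action) (k : Fin K) : |σ x a k| ≤ R / (1 - M.discount) := by
  have h1 := M.discount_lt_one
  have hσ : ∀ x a k, |σ x a k| ≤ ‖σ‖ := fun x a k =>
    ((norm_le_pi_norm (σ x a) k).trans (norm_le_pi_norm (σ x) a)).trans (norm_le_pi_norm σ x)
  -- A self-improving bound: the a priori bound `‖σ‖` passes once through the Bellman operator, and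
  -- `‖σ‖ ≤ R + γ ‖σ‖` is then solved for `‖σ‖`.
  have key : ∀ x a k, |σ x a k| ≤ R + M.discount * ‖σ‖ := fun x a k => by
    rw [← quantileStat_bellman_of_isFixedPt h]
    exact (M.supportedOn_bellman π hR (fun x' a' => supportedOn_uniformDiracs (hσ x' a')) x
      a).abs_quantile_le (level_pos k) (level_lt_one k)
  have h0 : 0 ≤ R + M.discount * ‖σ‖ := (abs_nonneg _).trans (key x a k)
  have hn : ‖σ‖ ≤ R + M.discount * ‖σ‖ :=
    (pi_norm_le_iff_of_nonneg h0).mpr fun x => (pi_norm_le_iff_of_nonneg h0).mpr fun a =>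
      (pi_norm_le_iff_of_nonneg h0).mpr fun k => key x a k
  refine (hσ x a k).trans ?_
  rw [le_div_iff₀ (by linarith)]
  linarith

end QuantileUpdate

/-! ### The law of the trajectory -/

lemma lintegral_initial (M : MDP.{u, v}) (x : M.State) (a : M.Action) {f : M.Step → ENNReal}
    (hf : Measurable f) :
    ∫⁻ s, f s ∂M.initial x a = ∫⁻ r, f ((x, a), r) ∂(M.reward x a : Measure ℝ) := by
  rw [initial, Measure.lintegral_compProd hf, lintegral_dirac]
  rfl

lemma lintegral_stepKernel (M : MDP.{u, v}) (π : M.Policy) (s₀ : M.Step) {f : M.Step → ENNReal}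
    (hf : Measurable f) :
    ∫⁻ s, f s ∂M.stepKernel π s₀ =
      ∫⁻ z, ∫⁻ r, f (z, r) ∂(M.reward z.1 z.2 : Measure ℝ) ∂M.pairKernel π s₀.1 := by
  rw [stepKernel, Kernel.comap_apply, Kernel.lintegral_compProd _ _ _ hf]
  rfl

lemma map_trajectoryLaw_zero (M : MDP.{u, v}) (π : M.Policy) (x : M.State) (a : M.Action) :
    (M.trajectoryLaw π x a).map (fun ω => ω 0) = M.initial x a := by
  have h : (fun ω : ℕ → M.Step => ω 0) =
      (MeasurableEquiv.piUnique fun _ : Finset.Iic 0 => M.Step) ∘ Preorder.frestrictLe 0 := rfl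
  rw [h, ← Measure.map_map (by fun_prop) (by fun_prop), trajectoryLaw, Kernel.trajMeasure,
    Measure.map_comp _ _ (by fun_prop), Kernel.traj_map_frestrictLe, Kernel.partialTraj_self,
    Measure.id_comp, Measure.map_map (by fun_prop) (by fun_prop)]
  convert Measure.map_id
  funext s
  exact (MeasurableEquiv.piUnique fun _ : Finset.Iic 0 => M.Step).apply_symm_apply s

lemma lintegral_trajectoryLaw_zero (M : MDP.{u, v}) (π : M.Policy) (x : M.State) (a : M.Action)
    {f : M.Step → ENNReal} (hf : Measurable f) :
    ∫⁻ ω, f (ω 0) ∂M.trajectoryLaw π x a = ∫⁻ r, f ((x, a), r) ∂(M.reward x a : Measure ℝ) := by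
  rw [← lintegral_initial M x a hf, ← map_trajectoryLaw_zero M π x a,
    lintegral_map hf (by fun_prop)]

/-- The Markov property of the trajectory. -/
lemma lintegral_trajectoryLaw_succ (M : MDP.{u, v}) (π : M.Policy) (x : M.State) (a : M.Action)
    (n : ℕ) {f : (Finset.Iic n → M.Step) × M.Step → ENNReal} (hf : Measurable f) :
    ∫⁻ ω, f (Preorder.frestrictLe n ω, ω (n + 1)) ∂M.trajectoryLaw π x a =
      ∫⁻ ω, ∫⁻ z, ∫⁻ r, f (Preorder.frestrictLe n ω, (z, r)) ∂(M.reward z.1 z.2 : Measure ℝ)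
        ∂M.pairKernel π (ω n).1 ∂M.trajectoryLaw π x a := by
  have h := Kernel.map_frestrictLe_trajMeasure_compProd_eq_map_trajMeasure
    (X := fun _ => M.Step) (κ := M.historyKernel π) (μ₀ := M.initial x a) (a := n)
  have h1 := congrArg (fun μ => ∫⁻ p, f p ∂μ) h
  rw [lintegral_map hf (by fun_prop), Measure.lintegral_compProd hf,
    lintegral_map (Measurable.lintegral_kernel_prod_right' hf) (by fun_prop)] at h1
  refine h1.symm.trans (lintegral_congr fun ω => ?_)
  exact M.lintegral_stepKernel π (ω n) (f := fun s => f (Preorder.frestrictLe n ω, s))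
    (by fun_prop)

/-- Given any state-action pair, a reward violates the bound with probability `0`, and there are
only countably many times. -/
lemma ae_reward_trajectoryLaw (M : MDP.{u, v}) (π : M.Policy) {R : ℝ}
    (hR : ∀ x a, SupportedOn R (M.reward x a : Measure ℝ)) (x : M.State) (a : M.Action) :
    ∀ᵐ ω ∂M.trajectoryLaw π x a, ∀ t, |(ω t).2| ≤ R := by
  set g : M.Step → ENNReal := fun s => (Set.Icc (-R) R)ᶜ.indicator 1 s.2 with hg
  have hgm : Measurable g :=
    (measurable_one.indicator measurableSet_Icc.compl).comp measurable_snd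
  have h0 : ∀ z : M.State × M.Action, ∫⁻ r, g (z, r) ∂(M.reward z.1 z.2 : Measure ℝ) = 0 :=
    fun z => by
      rw [hg, lintegral_indicator_one measurableSet_Icc.compl]
      exact hR z.1 z.2
  have key : ∀ t, ∫⁻ ω, g (ω t) ∂M.trajectoryLaw π x a = 0 := fun t => by
    cases t with
    | zero => exact (M.lintegral_trajectoryLaw_zero π x a hgm).trans (h0 (x, a))
    | succ n =>
      rw [M.lintegral_trajectoryLaw_succ π x a n (f := fun p => g p.2) (by fun_prop)]
      simp only [h0, lintegral_zero]
  refine ae_all_iff.mpr fun t => ?_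
  filter_upwards [(lintegral_eq_zero_iff (by fun_prop)).mp (key t)] with ω hω
  by_contra hne
  have : (ω t).2 ∈ (Set.Icc (-R) R)ᶜ := fun h => hne (abs_le.mpr h)
  simp [hg, Set.indicator_of_mem this] at hω

/-! ### Truncated returns -/

/-- The discounted return of the first `n` steps of a trajectory. -/
def partialReturn (M : MDP.{u, v}) (n : ℕ) (ω : ℕ → M.Step) : ℝ :=
  ∑ t ∈ Finset.range n, M.discount ^ t * (ω t).2

lemma measurable_partialReturn (M : MDP.{u, v}) (n : ℕ) : Measurable (M.partialReturn n) := by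
  unfold partialReturn
  fun_prop

/-- The probability of `c + γ ^ n Y ∈ s` when `Y` is drawn from `η` at the successor of `z`. -/
def continuation (M : MDP.{u, v}) (π : M.Policy) (η : M.State → M.Action → ProbabilityMeasure ℝ)
    (n : ℕ) (s : Set ℝ) (z : M.State × M.Action) (c : ℝ) : ENNReal :=
  ∫⁻ z', (η z'.1 z'.2 : Measure ℝ) ((fun y => c + M.discount ^ n * y) ⁻¹' s) ∂M.pairKernel π z

lemma measurable_continuation (M : MDP.{u, v}) (π : M.Policy)
    (η : M.State → M.Action → ProbabilityMeasure ℝ) (n : ℕ) {s : Set ℝ} (hs : MeasurableSet s) :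
    Measurable fun p : (M.State × M.Action) × ℝ => M.continuation π η n s p.1 p.2 := by
  refine measurable_from_prod_countable_right fun z => ?_
  simp only [continuation, lintegral_pairKernel]
  refine Finset.measurable_sum _ fun x' _ => Finset.measurable_sum _ fun a' _ =>
    Measurable.const_mul ?_ _
  have hf : Measurable fun q : ℝ × ℝ => q.1 + M.discount ^ n * q.2 := by fun_prop
  exact measurable_measure_prodMk_left (hf hs)

/-- One application of the operator moves one reward into the accumulated sum: `c + γ ^ n * (r + γ *
y) = (c + γ ^ n * r) + γ ^ (n + 1) * y`. -/
lemma bellman_preimage (M : MDP.{u, v}) (π : M.Policy)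
    (η : M.State → M.Action → ProbabilityMeasure ℝ) (n : ℕ) {s : Set ℝ} (hs : MeasurableSet s)
    (c : ℝ) (x : M.State) (a : M.Action) :
    (M.bellman π η x a : Measure ℝ) ((fun y => c + M.discount ^ n * y) ⁻¹' s) =
      ∫⁻ r, M.continuation π η (n + 1) s (x, a) (c + M.discount ^ n * r)
        ∂(M.reward x a : Measure ℝ) := by
  have hm : Measurable fun y => c + M.discount ^ n * y := by fun_prop
  have hs' := hm hs
  have hb : Measurable fun q : ℝ × (M.State × M.Action) => (η q.2.1 q.2.2 : Measure ℝ)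
      ((fun y => q.1 + M.discount * y) ⁻¹' ((fun y => c + M.discount ^ n * y) ⁻¹' s)) := by
    have hm : ∀ r, Measurable fun y => r + M.discount * y := fun r => by fun_prop
    simpa only [backupKernel_apply, Measure.map_apply (hm _) hs'] using
      Kernel.measurable_coe (M.backupKernel η) hs'
  rw [bellman_apply _ _ _ _ _ hs', transition, lintegral_prod _ hb.aemeasurable]
  refine lintegral_congr fun r => lintegral_congr fun z' => ?_
  congr 1
  ext y
  simp only [Set.mem_preimage]
  ring_nf

/-- Sampling `n + 1` steps and continuing with `η` gives the `(n + 1)`-fold Bellman update. -/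
lemma lintegral_continuation_trajectoryLaw (M : MDP.{u, v}) (π : M.Policy) (x : M.State)
    (a : M.Action) {s : Set ℝ} (hs : MeasurableSet s) (n : ℕ)
    (η : M.State → M.Action → ProbabilityMeasure ℝ) :
    ∫⁻ ω, M.continuation π η (n + 1) s (ω n).1 (M.partialReturn (n + 1) ω)
      ∂M.trajectoryLaw π x a = ((M.bellman π)^[n + 1] η x a : Measure ℝ) s := by
  -- The Markov property absorbs the last sampled step into the continuation and turns `η` into its
  -- Bellman image, so the induction hypothesis is needed at that other table.
  induction n generalizing η with
  | zero =>
    have hc := M.measurable_continuation π η (0 + 1) hs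
    have h1 := M.lintegral_trajectoryLaw_zero π x a
      (f := fun p => M.continuation π η (0 + 1) s p.1 p.2) hc
    have h2 := M.bellman_preimage π η 0 hs 0 x a
    simp only [pow_zero, one_mul, zero_add, Set.preimage_id'] at h1 h2
    simp only [partialReturn, zero_add, Finset.sum_range_one, pow_zero, one_mul]
    rw [h1, ← h2]
    rfl
  | succ n ih =>
    rw [Function.iterate_succ_apply, ← ih]
    have hc := M.measurable_continuation π η (n + 1 + 1) hs
    -- The truncated return as a function of the finite history alone, as the Markov property
    -- requires.
    set acc : (Finset.Iic n → M.Step) → ℝ := fun h => ∑ i : Finset.Iic n, M.discount ^ (i : ℕ) * (h i).2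
    have hacc : ∀ ω : ℕ → M.Step, acc (Preorder.frestrictLe n ω) = M.partialReturn (n + 1) ω :=
      fun ω => by
        rw [partialReturn, Nat.range_succ_eq_Iic,
          ← Finset.sum_coe_sort (Finset.Iic n) fun t => M.discount ^ t * (ω t).2]
        rfl
    have haccm : Measurable acc := Finset.measurable_sum _ fun i _ => by fun_prop
    have h := M.lintegral_trajectoryLaw_succ π x a n (f := fun p =>
      M.continuation π η (n + 1 + 1) s p.2.1 (acc p.1 + M.discount ^ (n + 1) * p.2.2))
      (hc.comp (f := fun p : (Finset.Iic n → M.Step) × M.Step =>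
        (p.2.1, acc p.1 + M.discount ^ (n + 1) * p.2.2)) (by fun_prop))
    simp only [hacc] at h
    have hsucc : ∀ ω : ℕ → M.Step, M.partialReturn (n + 1 + 1) ω =
        M.partialReturn (n + 1) ω + M.discount ^ (n + 1) * (ω (n + 1)).2 := fun ω => by
      rw [partialReturn, Finset.sum_range_succ, partialReturn]
    simp only [hsucc]
    rw [h]
    refine lintegral_congr fun ω => lintegral_congr fun z => ?_
    rw [bellman_preimage _ _ _ _ hs]

/-- The law of the truncated return is an iterate of the Bellman operator. -/
lemma map_partialReturn_trajectoryLaw (M : MDP.{u, v}) (π : M.Policy) (x : M.State) (a : M.Action)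
    (n : ℕ) :
    (M.trajectoryLaw π x a).map (M.partialReturn (n + 1)) =
      ((M.bellman π)^[n + 1] (fun _ _ => diracProba 0) x a : Measure ℝ) := by
  ext s hs
  rw [← lintegral_continuation_trajectoryLaw M π x a hs,
    ← lintegral_indicator_one hs, lintegral_map (measurable_one.indicator hs)
      (M.measurable_partialReturn _)]
  refine lintegral_congr fun ω => ?_
  -- Continuing with the zero return adds nothing to the accumulated sum.
  have : ∀ c : ℝ, (Measure.dirac (0 : ℝ)) ((fun y => c + M.discount ^ (n + 1) * y) ⁻¹' s) =
      s.indicator 1 c := fun c => by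
    have hm : Measurable fun y => c + M.discount ^ (n + 1) * y := by fun_prop
    rw [Measure.dirac_apply' _ (hm hs)]
    by_cases h : c ∈ s <;> simp [h]
  simp [continuation, diracProba, this]

lemma abs_partialReturn_sub_le (M : MDP.{u, v}) {R : ℝ} {ω : ℕ → M.Step}
    (h : ∀ t, |(ω t).2| ≤ R) (n : ℕ) :
    |M.partialReturn n ω - M.discountedReturn ω| ≤ R / (1 - M.discount) * M.discount ^ n := by
  have hb : ∀ t, ‖M.discount ^ t * (ω t).2‖ ≤ R * M.discount ^ t := fun t => by
    rw [norm_mul, Real.norm_of_nonneg (pow_nonneg M.discount_nonneg t), mul_comm]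
    exact mul_le_mul_of_nonneg_right (h t) (pow_nonneg M.discount_nonneg t)
  have hs : Summable fun t => M.discount ^ t * (ω t).2 :=
    Summable.of_norm_bounded ((summable_geometric_of_lt_one M.discount_nonneg
      M.discount_lt_one).mul_left R) hb
  refine (norm_sub_le_of_geometric_bound_of_hasSum M.discount_lt_one hb hs.hasSum n).trans_eq ?_
  ring

lemma supportedOn_returnDist (M : MDP.{u, v}) (π : M.Policy) {R : ℝ}
    (hR : ∀ x a, SupportedOn R (M.reward x a : Measure ℝ)) (x : M.State) (a : M.Action) :
    SupportedOn (R / (1 - M.discount)) (M.returnDist π x a : Measure ℝ) := by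
  refine (ae_map_iff M.measurable_discountedReturn.aemeasurable measurableSet_Icc).mpr ?_
  filter_upwards [M.ae_reward_trajectoryLaw π hR x a] with ω hω
  -- With no steps kept, the truncation error is the whole return.
  have := M.abs_partialReturn_sub_le hω 0
  rw [partialReturn, Finset.range_zero, Finset.sum_empty, zero_sub, abs_neg, pow_zero,
    mul_one] at this
  exact abs_le.mp this

/-- The truncated and the full return are coupled along the same trajectory, where they differ by a
geometric tail. -/
lemma cdfDist_returnDist_bellman_iterate_le (M : MDP.{u, v}) (π : M.Policy) {R : ℝ}
    (hR : ∀ x a, SupportedOn R (M.reward x a : Measure ℝ)) (x : M.State) (a : M.Action) (n : ℕ) :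
    cdfDist (M.returnDist π x a) ((M.bellman π)^[n + 1] (fun _ _ => diracProba 0) x a) ≤
      ENNReal.ofReal (R / (1 - M.discount) * M.discount ^ (n + 1)) := by
  rw [← map_partialReturn_trajectoryLaw, cdfDist_comm]
  refine (cdfDist_map_le _ (M.measurable_partialReturn _) M.measurable_discountedReturn).trans ?_
  calc _ ≤ ∫⁻ _, ENNReal.ofReal (R / (1 - M.discount) * M.discount ^ (n + 1))
        ∂M.trajectoryLaw π x a := by
        refine lintegral_mono_ae ?_
        filter_upwards [M.ae_reward_trajectoryLaw π hR x a] with ω hω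
        rw [edist_dist, Real.dist_eq]
        exact ENNReal.ofReal_le_ofReal (M.abs_partialReturn_sub_le hω _)
    _ = _ := by simp

end MDP

/-- The sign of the reward bound is not assumed; it follows from the existence of a reward law. -/
lemma SupportedOn.nonneg {B : ℝ} {μ : Measure ℝ} [IsProbabilityMeasure μ] (h : SupportedOn B μ) :
    0 ≤ B := by
  obtain ⟨y, hy⟩ := h.exists
  linarith [hy.1, hy.2]

namespace MDP

/-! ### The error of quantile dynamic programming -/

section QuantileError

variable {K : ℕ} [NeZero K] {M : MDP.{u, v}} {π : M.Policy} {R : ℝ}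
  {σ : M.State → M.Action → Fin K → ℝ}

/-- At a fixed point, the imputed distribution is the quantile projection of its own Bellman image,
so the distance is a single projection error on `[-B, B]` with `B = R / (1 - γ)`. This `B` satisfies
`R + γ B = B`, so the Bellman image stays in that interval. -/
lemma cdfDist_bellman_imputed_le (hR : ∀ x a, SupportedOn R (M.reward x a : Measure ℝ))
    (h : Function.IsFixedPt (M.update π (quantileStat K) (quantileImputation K)) σ)
    (x : M.State) (a : M.Action) :
    cdfDist (M.bellman π (M.imputed σ) x a) (M.imputed σ x a) ≤
      ENNReal.ofReal (R / (1 - M.discount) / K) := by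
  have h1 := M.discount_lt_one
  have hsupp := M.supportedOn_bellman π hR (η := M.imputed σ) (fun x' a' =>
    supportedOn_uniformDiracs (abs_le_of_isFixedPt hR h x' a')) x a
  have hB : R + M.discount * (R / (1 - M.discount)) = R / (1 - M.discount) := by
    have : 1 - M.discount ≠ 0 := by linarith
    field_simp
    ring
  rw [hB] at hsupp
  have hle := cdfDist_uniformDiracs_quantileStat_le (K := K) (μ := M.bellman π (M.imputed σ) x a)
    hsupp
  simp only [quantileStat_bellman_of_isFixedPt h] at hle
  rw [cdfDist_comm]
  exact hle

/-- The errors satisfy `e (n + 1) ≤ γ * e n + B / K`. The constant `B / K / (1 - γ)` is the fixed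
point of this recursion, and `2 * B` bounds the initial distance of two laws on `[-B, B]`. -/
lemma cdfDist_bellman_iterate_imputed_le
    (hR : ∀ x a, SupportedOn R (M.reward x a : Measure ℝ))
    (h : Function.IsFixedPt (M.update π (quantileStat K) (quantileImputation K)) σ) (n : ℕ)
    (x : M.State) (a : M.Action) :
    cdfDist ((M.bellman π)^[n] (fun _ _ => diracProba 0) x a) (M.imputed σ x a) ≤
      ENNReal.ofReal (R / (1 - M.discount) / K / (1 - M.discount) +
        2 * (R / (1 - M.discount)) * M.discount ^ n) := by
  have h0 := M.discount_nonneg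
  have h1 : 0 < 1 - M.discount := sub_pos.mpr M.discount_lt_one
  have hR0 : 0 ≤ R := (hR x a).nonneg
  set B := R / (1 - M.discount) with hB
  have hB0 : 0 ≤ B := div_nonneg hR0 h1.le
  have hc0 : 0 ≤ B / K / (1 - M.discount) := by positivity
  induction n generalizing x a with
  | zero =>
    have hsupp : SupportedOn B (diracProba (0 : ℝ) : Measure ℝ) := by
      exact (ae_dirac_iff (p := fun y => y ∈ Set.Icc (-B) B) measurableSet_Icc).mpr
        ⟨by linarith, hB0⟩
    have := isProbabilityMeasure_uniformDiracs (σ x a)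
    refine (cdfDist_le_of_supportedOn (ν := uniformDiracs (σ x a)) (ε := 1) hsupp (supportedOn_uniformDiracs
      (abs_le_of_isFixedPt hR h x a)) fun t => ?_).trans (ENNReal.ofReal_le_ofReal ?_)
    · exact abs_le.mpr
        ⟨by linarith [measureReal_le_one (μ := uniformDiracs (σ x a)) (s := Set.Iic t),
          measureReal_nonneg (μ := (diracProba (0 : ℝ) : Measure ℝ)) (s := Set.Iic t)],
        by linarith [measureReal_nonneg (μ := uniformDiracs (σ x a)) (s := Set.Iic t),
          measureReal_le_one (μ := (diracProba (0 : ℝ) : Measure ℝ)) (s := Set.Iic t)]⟩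
    · rw [pow_zero]
      linarith
  | succ n ih =>
    rw [Function.iterate_succ_apply']
    refine (cdfDist_triangle _ (M.bellman π (M.imputed σ) x a : Measure ℝ) _).trans ?_
    refine (add_le_add (M.cdfDist_bellman_le π ih x a)
      (cdfDist_bellman_imputed_le hR h x a)).trans_eq ?_
    rw [← ENNReal.ofReal_mul h0, ← hB, ← ENNReal.ofReal_add (by positivity) (by positivity)]
    congr 1
    field_simp
    ring

/-- The distributions imputed from the learnt quantiles are close to the return distributions. -/
lemma cdfDist_returnDist_imputed_le (hR : ∀ x a, SupportedOn R (M.reward x a : Measure ℝ))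
    (h : Function.IsFixedPt (M.update π (quantileStat K) (quantileImputation K)) σ)
    (x : M.State) (a : M.Action) :
    cdfDist (M.returnDist π x a) (M.imputed σ x a) ≤
      ENNReal.ofReal (R / (1 - M.discount) / K / (1 - M.discount)) := by
  have h0 := M.discount_nonneg
  have h1 : 0 < 1 - M.discount := sub_pos.mpr M.discount_lt_one
  have hR0 : 0 ≤ R := (hR x a).nonneg
  -- The factor `3` collects the truncation error `B * γ ^ (n + 1)` and the initial error `2 * B * γ
  -- ^ (n + 1)`; both vanish as `n` grows.
  have hle : ∀ n : ℕ, cdfDist (M.returnDist π x a) (M.imputed σ x a) ≤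
      ENNReal.ofReal (R / (1 - M.discount) / K / (1 - M.discount) +
        3 * (R / (1 - M.discount)) * M.discount ^ (n + 1)) := fun n => by
    refine (cdfDist_triangle _
      ((M.bellman π)^[n + 1] (fun _ _ => diracProba 0) x a : Measure ℝ) _).trans ?_
    refine (add_le_add (M.cdfDist_returnDist_bellman_iterate_le π hR x a n)
      (cdfDist_bellman_iterate_imputed_le hR h (n + 1) x a)).trans_eq ?_
    rw [← ENNReal.ofReal_add (by positivity) (by positivity)]
    congr 1
    ring
  have hpow := (tendsto_pow_atTop_nhds_zero_of_lt_one h0 M.discount_lt_one).comp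
    (tendsto_add_atTop_nat 1)
  have hlim := (hpow.const_mul (3 * (R / (1 - M.discount)))).const_add
    (R / (1 - M.discount) / K / (1 - M.discount))
  rw [mul_zero, add_zero] at hlim
  exact ge_of_tendsto' (ENNReal.tendsto_ofReal hlim) hle

lemma average_abs_quantileStat_returnDist_sub_le
    (hR : ∀ x a, SupportedOn R (M.reward x a : Measure ℝ))
    (h : Function.IsFixedPt (M.update π (quantileStat K) (quantileImputation K)) σ)
    (x : M.State) (a : M.Action) :
    (1 / (K : ℝ)) * ∑ k : Fin K, |quantileStat K k (M.returnDist π x a) - σ x a k| ≤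
      R * (2 - M.discount) / ((1 - M.discount) ^ 2 * K) := by
  have h0 := M.discount_nonneg
  have h1 : 0 < 1 - M.discount := sub_pos.mpr M.discount_lt_one
  have hR0 : 0 ≤ R := (hR x a).nonneg
  have hK : (0 : ℝ) < K := by exact_mod_cast Nat.pos_of_neZero K
  have := isProbabilityMeasure_uniformDiracs fun k : Fin K => quantileStat K k (M.returnDist π x a)
  -- The first summand is the cost of projecting the return distribution, the second its distance to
  -- the imputed one.
  have hc : R * (2 - M.discount) / ((1 - M.discount) ^ 2 * K) =
      R / (1 - M.discount) / K + R / (1 - M.discount) / K / (1 - M.discount) := by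
    field_simp
    ring
  rw [hc, ← ENNReal.ofReal_le_ofReal_iff (by positivity),
    ENNReal.ofReal_add (by positivity) (by positivity)]
  refine (ofReal_average_le_cdfDist_uniformDiracs (fun i j hij => quantileStat_mono K _ hij)
    (monotone_of_isFixedPt h x a)).trans ?_
  refine (cdfDist_triangle _ (M.returnDist π x a : Measure ℝ) _).trans ?_
  exact add_le_add (cdfDist_uniformDiracs_quantileStat_le (M.supportedOn_returnDist π hR x a))
    (cdfDist_returnDist_imputed_le hR h x a)

end QuantileError

end MDP

end DistRL

end

theorem theorem3 (γ : ℝ) (hγ : γ ∈ Set.Ico (0 : ℝ) 1) (Rmax : ℝ) (K : ℕ) [NeZero K] :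
    DistRL.ApproxBellmanClosed (DistRL.quantileStat K) (DistRL.quantileImputation K)
      (DistRL.boundedRewardMDPs.{u, v} γ Rmax)
      (2 * Rmax * (5 - 2 * γ) / ((1 - γ) ^ 2 * (K : ℝ))) := by
  rintro M ⟨rfl, hR⟩ π
  obtain ⟨σ, hσ⟩ := M.exists_isLearnt_quantileStat (K := K) π
  refine ⟨σ, hσ, ciSup_le fun z => ?_⟩
  refine (DistRL.MDP.average_abs_quantileStat_returnDist_sub_le hR hσ.isFixedPt z.1 z.2).trans ?_
  have hR0 : 0 ≤ Rmax := DistRL.SupportedOn.nonneg (hR z.1 z.2)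
  gcongr ?_ / _
  -- What remains is `2 - γ ≤ 2 * (5 - 2 * γ)`, multiplied by `Rmax ≥ 0`.
  nlinarith [hγ.1, hγ.2]
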